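/- Let $\mathcal{C}$ be the set of $\mathsf{S}\mathsf{K}$-combinators: $\mathsf{S},\mathsf{K}\in\mathcal{C}$, and $(NM)\in\mathcal{C}$ whenever $N,M\in\mathcal{C}$. The size of a combinator is its number of applications. Reduction is given by $\mathsf{K}xy\to x$ and $\mathsf{S}xyz\to xz(yz)$ applied to any subterm; a combinator is in normal form if it does not reduce to anything, and a normal-order step contracts the leftmost outermost redex. For $m\in\mathbb{N}=\{0,1,2,\dots\}$ let $\mathcal{R}_m$ be the set of combinators from which normal-order reduction reaches a normal form after exactly $m$ steps. For every $m\in\mathbb{N}$ the asymptotic density $$d_m=\lim_{n\to\infty}\frac{|\{t\in\mathcal{R}_m : t \text{ has size } n\}|}{|\{t\in\mathcal{C} : t \text{ has size } n\}|}$$ exists, and finding it is computable: there is an algorithm which, given $m,k\in\mathbb{N}$, outputs an integer $p$ such that $|d_m-p\,2^{-k}|\le 2^{-k}$. In particular every $d_m$ is a computable real number. -/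

import Mathlib

/-- `SK`-combinators: plane binary trees with leaves labelled by the primitive combinators. -/
inductive Comb : Type
  | S : Comb
  | K : Comb
  | app : Comb → Comb → Comb

namespace Comb

/-- The size of a combinator is its number of applications (inner nodes). -/
def size : Comb → ℕ
  | S => 0
  | K => 0
  | app x y => size x + size y + 1

/-- The reduction relation: `K x y → x`, `S x y z → x z (y z)`, anywhere in a combinator. -/
inductive Red : Comb → Comb → Prop
  | K (x y : Comb) : Red (app (app K x) y) x
  | S (x y z : Comb) : Red (app (app (app S x) y) z) (app (app x z) (app y z))
  | left {p q : Comb} (r : Comb) : Red p q → Red (app p r) (app q r)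
  | right {p q : Comb} (r : Comb) : Red p q → Red (app r p) (app r q)

/-- A combinator is in normal form if it does not reduce to anything. -/
def IsNormal (t : Comb) : Prop := ∀ u, ¬ Red t u

/-- One normal-order step: contract the leftmost outermost redex, if there is a redex.
If the combinator is itself a redex it is contracted; otherwise the step is made in the left
part of the application, or in its right part if the left part has no redex. -/
def step : Comb → Option Comb
  | S => none
  | K => none
  | app (app K x) _ => some x
  | app (app (app S x) y) z => some (app (app x z) (app y z))
  | app x y =>
    match step x with
    | some x' => some (app x' y)
    | none => (step y).map (app x)

/-- `t.NormalisesIn m`: normal-order reduction started at `t` reaches a normal form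
after exactly `m` steps. -/
def NormalisesIn : ℕ → Comb → Prop
  | 0, t => IsNormal t
  | m + 1, t => ∃ u, step t = some u ∧ NormalisesIn m u

theorem red_of_step (t : Comb) : ∀ u, step t = some u → Red t u := by
  fun_induction step t with
  | case1 => simp
  | case2 => simp
  | case3 x y => rintro u ⟨⟩; exact Red.K _ _
  | case4 x y z => rintro u ⟨⟩; exact Red.S _ _ _
  | case5 x y _ _ x' hx ih => rintro u ⟨⟩; exact Red.left _ (ih _ hx)
  | case6 x y _ _ hx _ ih =>
    intro u hu
    obtain ⟨y', hy, rfl⟩ := Option.map_eq_some_iff.1 hu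
    exact Red.right _ (ih _ hy)

/-- There is a normal-order step exactly when the combinator is not in normal form. -/
theorem step_eq_none_iff (t : Comb) : step t = none ↔ IsNormal t := by
  constructor
  · intro h u hu
    induction hu with
    | K x y => simp [step] at h
    | S x y z => simp [step] at h
    | left r hr ih =>
      unfold step at h
      split at h <;> simp_all
      split at h <;> simp_all
    | right r hr ih =>
      unfold step at h
      split at h <;> simp_all
      split at h <;> simp_all
  · intro h
    rcases hs : step t with _ | u
    · rfl
    · exact absurd (red_of_step t u hs) (h u)

/-- There are only finitely many combinators of each size. -/
theorem finite_size_eq (n : ℕ) : {t : Comb | t.size = n}.Finite := by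
  induction n using Nat.strong_induction_on with
  | _ n ih =>
    have h : (⋃ k ∈ Set.Iio n, {t : Comb | t.size = k}).Finite :=
      (Set.finite_Iio n).biUnion fun k hk => ih k hk
    refine ((Set.Finite.image2 app h h).union (Set.toFinite {S, K})).subset ?_
    rintro (_ | _ | ⟨x, y⟩) ht
    · simp
    · simp
    · left
      simp only [Set.mem_ofPred_eq, size] at ht
      exact ⟨x, by simp; omega, y, by simp; omega, rfl⟩

/-- There is a combinator of each size. -/
theorem exists_size_eq (n : ℕ) : ∃ t : Comb, t.size = n := by
  induction n with
  | zero => exact ⟨S, rfl⟩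
  | succ n ih => obtain ⟨t, ht⟩ := ih; exact ⟨app S t, by simp [size, ht]⟩

/-- The number of members of `A` of size `n`. -/
noncomputable def count (A : Set Comb) (n : ℕ) : ℕ := {t ∈ A | t.size = n}.ncard

/-- `A` has asymptotic density `d` in the set of all combinators. -/
def HasDensity (A : Set Comb) (d : ℝ) : Prop :=
  Filter.Tendsto (fun n => (count A n : ℝ) / (count Set.univ n : ℝ)) Filter.atTop (nhds d)

end Comb

/-- A sequence of real numbers is computable if one algorithm, given `m` and a precision `k`,
returns an integer `p` with `|x m - p / 2 ^ k| ≤ 1 / 2 ^ k`. In particular every `x m` is a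
computable real number, and an algorithm for it can be found from `m`. -/
def IsComputableRealSeq (x : ℕ → ℝ) : Prop :=
  ∃ p : ℕ → ℕ → ℤ, Computable₂ p ∧ ∀ m k, |x m - (p m k : ℝ) / 2 ^ k| ≤ 1 / 2 ^ k

/-!
A combinator of large size looks, near its root, like an infinite tree, and `m` normal-order steps
usually inspect only finitely many nodes of that tree. The proof makes this effective. A combinator
`t` is cut off at depth `J`, the cut places become holes, and normal-order reduction is run lazily
on the resulting pattern `trunc J t` until it meets a hole. If it does not meet one in the first
`m + 1` searches for a redex, then `trunc J t` already decides whether `t` reaches a normal form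
after exactly `m` steps (`Pattern.Matches.normalisesIn_iff`).

The combinators with a given truncation have the generating series `X ^ k * C ^ j`, where `k` and
`j` count the inner nodes and the holes of the truncation and `C` is the series of all combinators.
The equation `C = 2 + X * C ^ 2` and the limit `8` of the ratios of consecutive coefficients of `C`
give such a series the density `j * 4 ^ (j - 1) / 8 ^ k`. So the truncations that are accepted and
those that are undecided have explicit rational densities `acceptedDensity m J` and
`undecidedDensity m J`, and the density of the combinators normalising in `m` steps is squeezed
between the first and the sum of both, once `undecidedDensity m J` is known to tend to `0` as `J`
grows.

For this limit, call a hole sparse for `m` if on the path to it from the root at most `m` right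
turns pass a left sibling equal to the redex `K K K`. A hole at which the search for the leftmost
outermost redex gets stuck is sparse for `0`, since every left sibling has been found to be normal,
and undoing a reduction step raises the number by at most one
(`Pattern.SparseHole.of_step`). So an undecided truncation has a hole at depth `J` that is sparse
for `m` (`Pattern.Undecided.sparseHole`). Each level of such a path contributes a factor
`(4 + (4 - 1 / 64)) / 8 < 1`, except for at most `m` levels, and hence the density of the
combinators with such a path is summable over `J` (`Comb.vanishing_sparseHole`).

The algorithm searches for a depth `J` with `undecidedDensity m J ≤ 2 ^ (-k)`, which exists by the
limit, and rounds `acceptedDensity m J`. Both densities are finite sums over a list of patterns and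
are primitive recursive in `m` and `J`.
-/

/-! ### Patterns and lazy reduction -/

/-- Combinators with holes. A hole stands for an unknown combinator, and different holes are
unrelated. -/
inductive Pattern : Type
  | S : Pattern
  | K : Pattern
  | hole : Pattern
  | app : Pattern → Pattern → Pattern
  deriving DecidableEq

namespace Pattern

/-- One lazy normal-order step. The result is `none` if the search for the leftmost outermost
redex meets a hole, `some none` if it ends without meeting a hole or a redex, and `some (some q)`
if the redex found first is contracted, giving `q`. -/
def step : Pattern → Option (Option Pattern)
  | S => some none
  | K => some none
  | hole => none
  | app (app K x) _ => some (some x)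
  | app (app (app S x) y) z => some (some (app (app x z) (app y z)))
  | app x y =>
    match step x with
    | none => none
    | some (some x') => some (some (app x' y))
    | some none => (step y).map (Option.map (app x))

/-- `Matches p t`: the combinator `t` arises from `p` by filling the holes. -/
inductive Matches : Pattern → Comb → Prop
  | S : Matches S Comb.S
  | K : Matches K Comb.K
  | hole (t : Comb) : Matches hole t
  | app {p q : Pattern} {s t : Comb} :
    Matches p s → Matches q t → Matches (app p q) (Comb.app s t)

/-- The result of cutting off a combinator at depth `J`. -/
def trunc : ℕ → Comb → Pattern
  | 0, _ => hole
  | _ + 1, Comb.S => S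
  | _ + 1, Comb.K => K
  | J + 1, Comb.app x y => app (trunc J x) (trunc J y)

theorem matches_trunc (J : ℕ) (t : Comb) : Matches (trunc J t) t := by
  induction J generalizing t with
  | zero => exact .hole t
  | succ J ih =>
    cases t with
    | S => exact .S
    | K => exact .K
    | app x y => exact .app (ih x) (ih y)

/-- If lazy reduction of `p` is not stuck, then a partial application of `K` matches `p` only if
`p` itself is one. -/
theorem Matches.eq_K_app {p : Pattern} {x : Comb} (h : Matches p (Comb.app Comb.K x))
    (hp : step p ≠ none) : ∃ q, p = Pattern.app Pattern.K q := by
  rcases h with _ | _ | _ | ⟨_ | _ | _ | _, _⟩ <;> simp_all [step]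

/-- If lazy reduction of `p` is not stuck, then a partial application of `S` to two arguments
matches `p` only if `p` itself is one. -/
theorem Matches.eq_S_app {p : Pattern} {x y : Comb}
    (h : Matches p (Comb.app (Comb.app Comb.S x) y)) (hp : step p ≠ none) :
    ∃ q r, p = Pattern.app (Pattern.app Pattern.S q) r := by
  rcases h with _ | _ | _ | ⟨_ | _ | _ | ⟨_ | _, _⟩, _⟩ <;> simp_all [step]

theorem Matches.step_eq_none {p : Pattern} {t : Comb} (h : Matches p t)
    (hp : step p = some none) : t.step = none := by
  fun_induction step p generalizing t with
  | case1 => cases h; rfl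
  | case2 => cases h; rfl
  | case3 => simp at hp
  | case4 => simp at hp
  | case5 => simp at hp
  | case6 => simp at hp
  | case7 => simp at hp
  | case8 x y h1 h2 hx ihx ihy =>
    rcases h with _ | _ | _ | ⟨hs, ht⟩
    rw [Comb.step, ihx hs hx, ihy ht (by simpa using hp)]
    · rfl
    · rintro a rfl
      obtain ⟨q, rfl⟩ := hs.eq_K_app (by simp [hx])
      exact h1 q rfl
    · rintro a b rfl
      obtain ⟨q, r, rfl⟩ := hs.eq_S_app (by simp [hx])
      exact h2 q r rfl

theorem Matches.step_eq_some {p p' : Pattern} {t : Comb} (h : Matches p t)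
    (hp : step p = some (some p')) : ∃ t', t.step = some t' ∧ Matches p' t' := by
  fun_induction step p generalizing p' t with
  | case1 => simp at hp
  | case2 => simp at hp
  | case3 => simp at hp
  | case4 x y =>
    obtain rfl : x = p' := by simpa using hp
    rcases h with _ | _ | _ | ⟨_ | _ | _ | ⟨_ | _, hx⟩, hy⟩
    exact ⟨_, by simp [Comb.step], hx⟩
  | case5 x y z =>
    obtain rfl := by simpa using hp
    rcases h with _ | _ | _ | ⟨_ | _ | _ | ⟨_ | _ | _ | ⟨_ | _, hx⟩, hy⟩, hz⟩
    exact ⟨_, by simp [Comb.step], .app (.app hx hz) (.app hy hz)⟩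
  | case6 => simp at hp
  | case7 x y h1 h2 x' hx ih =>
    obtain rfl : Pattern.app x' y = p' := by simpa using hp
    rcases h with _ | _ | _ | ⟨hs, ht⟩
    obtain ⟨s', hs', hm⟩ := ih hs hx
    refine ⟨_, ?_, .app hm ht⟩
    rw [Comb.step, hs']
    · rintro a rfl
      obtain ⟨q, rfl⟩ := hs.eq_K_app (by simp [hx])
      exact h1 q rfl
    · rintro a b rfl
      obtain ⟨q, r, rfl⟩ := hs.eq_S_app (by simp [hx])
      exact h2 q r rfl
  | case8 x y h1 h2 hx ihx ihy =>
    rcases h with _ | _ | _ | ⟨hs, ht⟩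
    obtain ⟨y', hy', rfl⟩ : ∃ y', step y = some (some y') ∧ Pattern.app x y' = p' := by
      rcases hy : step y with _ | _ | y' <;> simp_all
    obtain ⟨t', ht', hm⟩ := ihy ht hy'
    refine ⟨_, ?_, .app hs hm⟩
    rw [Comb.step, hs.step_eq_none hx, ht']
    · rfl
    · rintro a rfl
      obtain ⟨q, rfl⟩ := hs.eq_K_app (by simp [hx])
      exact h1 q rfl
    · rintro a b rfl
      obtain ⟨q, r, rfl⟩ := hs.eq_S_app (by simp [hx])
      exact h2 q r rfl

/-- The state of lazy reduction after `m` attempted steps: `none` if a hole has been met,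
`some none` if a normal form was recognised during these attempts, and `some (some q)` if `m`
steps have been made and led to `q`. -/
def run : ℕ → Pattern → Option (Option Pattern)
  | 0, p => some (some p)
  | m + 1, p => (step p).bind fun r => r.elim (some none) (run m)

/-- Lazy reduction of the pattern recognises a normal form after exactly `m` steps. -/
def Accepts (m : ℕ) (p : Pattern) : Prop := run (m + 1) p = some none ∧ run m p ≠ some none

/-- Lazy reduction of the pattern meets a hole before it is known whether normal-order reduction
ends after exactly `m` steps. -/
def Undecided (m : ℕ) (p : Pattern) : Prop := run (m + 1) p = none

instance (m : ℕ) : DecidablePred (Accepts m) := fun _ => inferInstanceAs (Decidable (_ ∧ _))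

instance (m : ℕ) : DecidablePred (Undecided m) := fun _ => inferInstanceAs (Decidable (_ = _))

theorem not_undecided_of_accepts {m : ℕ} {p : Pattern} (h : Accepts m p) : ¬ Undecided m p := by
  simp [Undecided, h.1]

theorem run_succ (m : ℕ) (p : Pattern) :
    run (m + 1) p = (step p).bind fun r => r.elim (some none) (run m) := rfl

/-- Lazy reduction is correct for all combinators that match the pattern, unless it is undecided. -/
theorem Matches.normalisesIn_iff {m : ℕ} {p : Pattern} {t : Comb} (h : Matches p t)
    (hp : ¬ Undecided m p) : t.NormalisesIn m ↔ Accepts m p := by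
  induction m generalizing p t with
  | zero =>
    rcases hs : step p with _ | _ | p'
    · simp [Undecided, run, hs] at hp
    · simp [Accepts, run, hs, Comb.NormalisesIn, ← Comb.step_eq_none_iff, h.step_eq_none hs]
    · obtain ⟨t', ht', -⟩ := h.step_eq_some hs
      simp [Accepts, run, hs, Comb.NormalisesIn, ← Comb.step_eq_none_iff, ht']
  | succ m ih =>
    rcases hs : step p with _ | _ | p'
    · simp [Undecided, run, hs] at hp
    · simp [Accepts, run, hs, Comb.NormalisesIn, h.step_eq_none hs]
    · obtain ⟨t', ht', hm⟩ := h.step_eq_some hs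
      have hp' : ¬ Undecided m p' := by simpa [Undecided, run_succ _ p, hs] using hp
      simp [Accepts, run_succ _ p, hs, Comb.NormalisesIn, ht', ih hm hp']

/-! ### Where lazy reduction gets stuck -/

/-- The pattern `K K K`, which is a redex. -/
def kkk : Pattern := app (app K K) K

/-- `SparseHole m p`: some hole of `p` can be reached from the root such that at most `m` times
the path turns right at a node whose left child is the redex `K K K`. -/
inductive SparseHole : ℕ → Pattern → Prop
  | hole (m : ℕ) : SparseHole m hole
  | left {m : ℕ} {p : Pattern} (q : Pattern) : SparseHole m p → SparseHole m (app p q)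
  | right {m : ℕ} {p q : Pattern} : p ≠ kkk → SparseHole m q → SparseHole m (app p q)
  | skip {m : ℕ} (p : Pattern) {q : Pattern} : SparseHole m q → SparseHole (m + 1) (app p q)

theorem SparseHole.succ {m : ℕ} {p : Pattern} (h : SparseHole m p) : SparseHole (m + 1) p := by
  induction h with
  | hole m => exact .hole _
  | left q _ ih => exact .left q ih
  | right hp _ ih => exact .right hp ih
  | skip p _ ih => exact .skip p ih

theorem SparseHole.mono {m n : ℕ} {p : Pattern} (h : SparseHole m p) (hmn : m ≤ n) :
    SparseHole n p := by
  induction hmn with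
  | refl => exact h
  | step _ ih => exact ih.succ

/-- The search for a redex reaches a hole only after it has found every left sibling along the path
to be normal. -/
theorem sparseHole_of_step_eq_none {p : Pattern} (h : step p = none) : SparseHole 0 p := by
  fun_induction step p with
  | case1 => simp at h
  | case2 => simp at h
  | case3 => exact .hole _
  | case4 => simp at h
  | case5 => simp at h
  | case6 x y _ _ hx ih => exact .left y (ih hx)
  | case7 => simp at h
  | case8 x y _ _ hx _ ih =>
    refine .right ?_ (ih (by simpa using h))
    rintro rfl
    simp [kkk, step] at hx

/-- Undoing a reduction step costs at most one occurrence of `K K K` beside the path to a hole: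
if the redex lies beside the path then only one sibling changes, and if it lies on the path then
the path is rearranged within the redex, where at most one argument becomes a new sibling. -/
theorem SparseHole.of_step {p q : Pattern} {m : ℕ} (hs : step p = some (some q))
    (h : SparseHole m q) : SparseHole (m + 1) p := by
  fun_induction step p generalizing q m with
  | case1 => simp at hs
  | case2 => simp at hs
  | case3 => simp at hs
  | case4 x y =>
    obtain rfl : x = q := by simpa using hs
    exact .left _ (.skip _ h)
  | case5 x y z =>
    obtain rfl := by simpa using hs
    have hx {k : ℕ} (hk : SparseHole k x) : SparseHole k (Pattern.app (.app (.app .S x) y) z) :=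
      .left _ (.left _ (.right (by simp [kkk]) hk))
    have hxz {k : ℕ} (hk : SparseHole k (Pattern.app x z)) :
        SparseHole (k + 1) (Pattern.app (.app (.app .S x) y) z) := by
      cases hk with
      | left _ h => exact (hx h).succ
      | right _ h => exact .skip _ h
      | skip _ h => exact .skip _ h.succ
    have hyz {k : ℕ} (hk : SparseHole k (Pattern.app y z)) :
        SparseHole (k + 1) (Pattern.app (.app (.app .S x) y) z) := by
      cases hk with
      | left _ h => exact .left _ (.skip _ h)
      | right _ h => exact .skip _ h
      | skip _ h => exact .skip _ h.succ
    cases h with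
    | left _ h => exact hxz h
    | right _ h => exact hyz h
    | skip _ h => exact (hyz h).succ
  | case6 => simp at hs
  | case7 x y _ _ x' hx ih =>
    obtain rfl : app x' y = q := by simpa using hs
    cases h with
    | left _ h => exact .left _ (ih hx h)
    | right _ h => exact .skip _ h
    | skip _ h => exact .skip _ h.succ
  | case8 x y _ _ hx _ ih =>
    obtain ⟨y', hy', rfl⟩ : ∃ y', step y = some (some y') ∧ app x y' = q := by
      rcases hy : step y with _ | _ | y' <;> simp_all
    cases h with
    | left _ h => exact .left _ h.succ
    | right hn h => exact .right hn (ih hy' h)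
    | skip _ h => exact .skip _ (ih hy' h)

/-- Lazy reduction that gets stuck after `i ≤ m` steps gets stuck at a hole with only normal left
siblings along its path, and undoing the `i` steps adds at most `i` siblings `K K K`. -/
theorem Undecided.sparseHole {m : ℕ} {p : Pattern} (h : Undecided m p) : SparseHole m p := by
  induction m generalizing p with
  | zero =>
    refine sparseHole_of_step_eq_none ?_
    rcases hs : step p with _ | _ | p' <;> simp [Undecided, run, hs] at h ⊢
  | succ m ih =>
    rcases hs : step p with _ | _ | p'
    · exact (sparseHole_of_step_eq_none hs).mono (Nat.zero_le _)
    · simp [Undecided, run, hs] at h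
    · exact (ih (by simpa [Undecided, run_succ _ p, hs] using h)).of_step hs

end Pattern

/-! ### Generating series and densities -/

namespace Comb

open Filter Topology

/-- The generating series of a set of combinators, by size. -/
noncomputable def series (A : Set Comb) : PowerSeries ℝ := PowerSeries.mk fun n => (count A n : ℝ)

@[simp]
theorem coeff_series (A : Set Comb) (n : ℕ) :
    PowerSeries.coeff n (series A) = (count A n : ℝ) := PowerSeries.coeff_mk _ _

theorem finite_sep (A : Set Comb) (n : ℕ) : {t ∈ A | t.size = n}.Finite :=
  (finite_size_eq n).subset fun _ h => h.2

theorem count_mono {A B : Set Comb} (h : A ⊆ B) (n : ℕ) : count A n ≤ count B n :=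
  Set.ncard_le_ncard (fun _ ht => ⟨h ht.1, ht.2⟩) (finite_sep B n)

theorem count_union_le (A B : Set Comb) (n : ℕ) : count (A ∪ B) n ≤ count A n + count B n := by
  refine le_trans (Set.ncard_le_ncard ?_ ((finite_sep A n).union (finite_sep B n)))
    (Set.ncard_union_le _ _)
  rintro t ⟨h | h, ht⟩
  · exact Or.inl ⟨h, ht⟩
  · exact Or.inr ⟨h, ht⟩

theorem count_union_of_disjoint {A B : Set Comb} (h : Disjoint A B) (n : ℕ) :
    count (A ∪ B) n = count A n + count B n := by
  rw [count, count, count, ← Set.ncard_union_eq _ (finite_sep A n) (finite_sep B n)]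
  · congr 1
    ext t
    simp only [Set.mem_ofPred_eq, Set.mem_union]
    tauto
  · exact Set.disjoint_left.2 fun t hA hB => Set.disjoint_left.1 h hA.1 hB.1

theorem count_univ_pos (n : ℕ) : 0 < count Set.univ n := by
  obtain ⟨t, ht⟩ := exists_size_eq n
  exact (Set.ncard_pos (finite_sep _ n)).2 ⟨t, trivial, ht⟩

theorem count_image2_app_succ (A B : Set Comb) (n : ℕ) :
    count (Set.image2 app A B) (n + 1) =
      ∑ ij ∈ Finset.HasAntidiagonal.antidiagonal n, count A ij.1 * count B ij.2 := by
  classical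
  have key : (finite_sep (Set.image2 app A B) (n + 1)).toFinset =
      (Finset.HasAntidiagonal.antidiagonal n).biUnion fun ij =>
        ((finite_sep A ij.1).toFinset ×ˢ (finite_sep B ij.2).toFinset).image
          fun xy => app xy.1 xy.2 := by
    ext t
    simp only [Set.Finite.mem_toFinset, Set.mem_ofPred_eq, Set.mem_image2, Finset.mem_biUnion,
      Finset.HasAntidiagonal.mem_antidiagonal, Finset.mem_image, Finset.mem_product, Prod.exists]
    constructor
    · rintro ⟨⟨x, hx, y, hy, rfl⟩, ht⟩
      exact ⟨x.size, y.size, by simpa [size] using ht, x, y, ⟨⟨hx, rfl⟩, hy, rfl⟩, rfl⟩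
    · rintro ⟨i, j, hij, x, y, ⟨⟨hx, rfl⟩, hy, rfl⟩, rfl⟩
      exact ⟨⟨x, hx, y, hy, rfl⟩, by simp [size, hij]⟩
  rw [count, Set.ncard_eq_toFinset_card _ (finite_sep _ _), key, Finset.card_biUnion]
  · refine Finset.sum_congr rfl fun ij _ => ?_
    rw [Finset.card_image_of_injective, Finset.card_product, count, count,
      Set.ncard_eq_toFinset_card _ (finite_sep _ _), Set.ncard_eq_toFinset_card _ (finite_sep _ _)]
    rintro ⟨x, y⟩ ⟨x', y'⟩ h
    simpa using h
  · rintro ⟨i, j⟩ _ ⟨i', j'⟩ _ hne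
    rw [Function.onFun, Finset.disjoint_left]
    simp only [Finset.mem_image, Finset.mem_product, Set.Finite.mem_toFinset, Set.mem_ofPred_eq]
    rintro _ ⟨⟨x, y⟩, ⟨⟨_, rfl⟩, _, rfl⟩, rfl⟩ ⟨⟨x', y'⟩, ⟨⟨_, rfl⟩, _, rfl⟩, h⟩
    simp only [app.injEq] at h
    exact hne (by rw [h.1, h.2])

theorem series_image2_app (A B : Set Comb) :
    series (Set.image2 app A B) = PowerSeries.X * (series A * series B) := by
  ext n
  cases n with
  | zero =>
    have : {t ∈ Set.image2 app A B | t.size = 0} = ∅ := by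
      ext t
      simp only [Set.mem_ofPred_eq, Set.mem_empty_iff_false, iff_false, not_and]
      rintro ⟨x, _, y, _, rfl⟩
      simp [size]
    rw [coeff_series, count, this]
    simp
  | succ n =>
    rw [PowerSeries.coeff_succ_X_mul, coeff_series, count_image2_app_succ, PowerSeries.coeff_mul]
    simp

theorem series_singleton (t : Comb) : series {t} = PowerSeries.X ^ t.size := by
  ext n
  rw [coeff_series, PowerSeries.coeff_X_pow]
  split
  · have : {u ∈ ({t} : Set Comb) | u.size = n} = {t} := by
      ext u
      simp only [Set.mem_singleton_iff, Set.mem_ofPred_eq, and_iff_left_iff_imp]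
      rintro rfl
      omega
    rw [count, this]
    simp
  · have : {u ∈ ({t} : Set Comb) | u.size = n} = ∅ := by
      ext u
      simp only [Set.mem_singleton_iff, Set.mem_ofPred_eq, Set.mem_empty_iff_false, iff_false,
        not_and]
      rintro rfl
      omega
    rw [count, this]
    simp

theorem count_univ_zero : count Set.univ 0 = 2 := by
  have : {t ∈ (Set.univ : Set Comb) | t.size = 0} = {S, K} := by
    ext t
    cases t <;> simp [size]
  rw [count, this, Set.ncard_pair (by simp)]

theorem count_univ_succ (n : ℕ) :
    count Set.univ (n + 1) =
      ∑ ij ∈ Finset.HasAntidiagonal.antidiagonal n, count Set.univ ij.1 * count Set.univ ij.2 := by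
  rw [← count_image2_app_succ, count, count]
  congr 1
  ext t
  cases t <;> simp [size]

theorem series_univ_eq :
    series Set.univ = 2 + PowerSeries.X * (series Set.univ * series Set.univ) := by
  ext n
  cases n with
  | zero =>
    simp [count_univ_zero, map_ofNat]
  | succ n =>
    have : PowerSeries.coeff (n + 1) (2 : PowerSeries ℝ) = 0 := by
      rw [← map_ofNat (PowerSeries.C (R := ℝ)) 2, PowerSeries.coeff_C]
      simp
    rw [map_add, this, PowerSeries.coeff_succ_X_mul, coeff_series, count_univ_succ,
      PowerSeries.coeff_mul]
    simp

theorem count_univ (n : ℕ) : count Set.univ n = 2 ^ (n + 1) * catalan n := by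
  induction n using Nat.strong_induction_on with
  | _ n ih =>
    cases n with
    | zero => simp [count_univ_zero]
    | succ n =>
      rw [count_univ_succ, catalan_succ', Finset.mul_sum]
      refine Finset.sum_congr rfl fun ij hij => ?_
      rw [Finset.HasAntidiagonal.mem_antidiagonal] at hij
      rw [ih _ (by omega), ih _ (by omega), ← hij]
      ring

theorem add_two_mul_count_univ_succ (n : ℕ) :
    (n + 2) * count Set.univ (n + 1) = 4 * (2 * n + 1) * count Set.univ n := by
  have h1 := succ_mul_catalan_eq_centralBinom (n + 1)
  have h2 := succ_mul_catalan_eq_centralBinom n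
  have h3 := Nat.succ_mul_centralBinom_succ n
  rw [← h1, ← h2] at h3
  have h4 : (n + 2) * catalan (n + 1) = 2 * (2 * n + 1) * catalan n := by
    refine Nat.eq_of_mul_eq_mul_left (show 0 < n + 1 by omega) ?_
    calc _ = (n + 1) * ((n + 1 + 1) * catalan (n + 1)) := by ring
      _ = _ := by rw [h3]; ring
  rw [count_univ, count_univ]
  calc _ = 2 ^ (n + 1 + 1) * ((n + 2) * catalan (n + 1)) := by ring
    _ = _ := by rw [h4]; ring

theorem tendsto_count_univ_succ_div :
    Tendsto (fun n => (count Set.univ (n + 1) : ℝ) / (count Set.univ n : ℝ)) atTop (𝓝 8) := by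
  have h : (fun n => (count Set.univ (n + 1) : ℝ) / (count Set.univ n : ℝ)) =
      fun n : ℕ => 8 - 12 * (1 / ((n + 2 : ℕ) : ℝ)) := by
    ext n
    have h0 : (count Set.univ n : ℝ) ≠ 0 := by exact_mod_cast (count_univ_pos n).ne'
    have h2 : ((n : ℝ) + 2) ≠ 0 := by positivity
    have h1 : ((n : ℝ) + 2) * count Set.univ (n + 1) = 4 * (2 * n + 1) * count Set.univ n := by
      exact_mod_cast add_two_mul_count_univ_succ n
    push_cast
    field_simp
    linear_combination h1
  rw [h]
  have := (tendsto_const_div_atTop_nhds_zero_nat (1 : ℝ)).comp (tendsto_add_atTop_nat 2)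
  simpa [Function.comp_def] using (this.const_mul 12).const_sub (8 : ℝ)

/-- The coefficients of `f`, divided by the numbers of combinators, converge to `d`. -/
def HasSeriesDensity (f : PowerSeries ℝ) (d : ℝ) : Prop :=
  Tendsto (fun n => PowerSeries.coeff n f / (count Set.univ n : ℝ)) atTop (𝓝 d)

theorem hasDensity_iff {A : Set Comb} {d : ℝ} :
    HasDensity A d ↔ HasSeriesDensity (series A) d := by
  simp [HasDensity, HasSeriesDensity]

namespace HasSeriesDensity

variable {f g : PowerSeries ℝ} {a b : ℝ}

theorem add (hf : HasSeriesDensity f a) (hg : HasSeriesDensity g b) :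
    HasSeriesDensity (f + g) (a + b) := by
  simpa [HasSeriesDensity, add_div] using Tendsto.add hf hg

theorem sub (hf : HasSeriesDensity f a) (hg : HasSeriesDensity g b) :
    HasSeriesDensity (f - g) (a - b) := by
  simpa [HasSeriesDensity, sub_div] using Tendsto.sub hf hg

theorem X_mul (hf : HasSeriesDensity f a) : HasSeriesDensity (PowerSeries.X * f) (a / 8) := by
  rw [HasSeriesDensity, ← tendsto_add_atTop_iff_nat 1]
  refine (Tendsto.div hf tendsto_count_univ_succ_div (by norm_num)).congr fun n => ?_
  have h0 : (count Set.univ n : ℝ) ≠ 0 := by exact_mod_cast (count_univ_pos n).ne'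
  have h1 : (count Set.univ (n + 1) : ℝ) ≠ 0 := by exact_mod_cast (count_univ_pos (n + 1)).ne'
  rw [PowerSeries.coeff_succ_X_mul, Pi.div_apply]
  field_simp

theorem of_X_mul (hf : HasSeriesDensity (PowerSeries.X * f) a) : HasSeriesDensity f (8 * a) := by
  rw [HasSeriesDensity, ← tendsto_add_atTop_iff_nat 1] at hf
  refine (Tendsto.mul tendsto_count_univ_succ_div hf).congr fun n => ?_
  have h0 : (count Set.univ n : ℝ) ≠ 0 := by exact_mod_cast (count_univ_pos n).ne'
  have h1 : (count Set.univ (n + 1) : ℝ) ≠ 0 := by exact_mod_cast (count_univ_pos (n + 1)).ne'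
  rw [PowerSeries.coeff_succ_X_mul]
  field_simp

theorem zero : HasSeriesDensity 0 0 := by
  simp [HasSeriesDensity]

theorem one : HasSeriesDensity 1 0 := by
  rw [HasSeriesDensity, ← tendsto_add_atTop_iff_nat 1]
  simp [PowerSeries.coeff_one]

/-- The value is the derivative of `y ^ j` at `y = 4`, the value of the series of all combinators
at its radius of convergence `1 / 8`. It follows from the quadratic equation of that series and
from the ratio of consecutive coefficients alone. -/
theorem series_univ_pow (j : ℕ) :
    HasSeriesDensity (series Set.univ ^ j) (j * 4 ^ j / 4) := by
  induction j using Nat.twoStepInduction with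
  | zero => simpa using one
  | one =>
    have h : ∀ n, (count Set.univ n : ℝ) / (count Set.univ n : ℝ) = 1 := fun n =>
      div_self (by exact_mod_cast (count_univ_pos n).ne')
    simp [HasSeriesDensity, h]
  | more j h0 h1 =>
    have key : PowerSeries.X * series Set.univ ^ (j + 2) =
        series Set.univ ^ (j + 1) - (series Set.univ ^ j + series Set.univ ^ j) := by
      have := series_univ_eq
      linear_combination (-series Set.univ ^ j) * this
    have h2 := h1.sub (h0.add h0)
    rw [← key] at h2
    convert h2.of_X_mul using 1
    push_cast
    ring

end HasSeriesDensity

/-- `f` behaves to first order like a polynomial `P (X, C)` in `X` and the series `C` of all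
combinators, where `v` and `d` are the values of `P` and `∂P/∂C` at the singularity
`X = 1 / 8`, `C = 4`. -/
def HasExpansion (f : PowerSeries ℝ) (v d : ℝ) : Prop :=
  ∀ j : ℕ, HasSeriesDensity (f * series Set.univ ^ j) (d * 4 ^ j + v * (j * 4 ^ j / 4))

namespace HasExpansion

variable {f g : PowerSeries ℝ} {v w d e : ℝ}

theorem hasSeriesDensity (h : HasExpansion f v d) : HasSeriesDensity f d := by
  simpa using h 0

theorem one : HasExpansion 1 1 0 := fun j => by
  simpa using HasSeriesDensity.series_univ_pow j

theorem zero : HasExpansion 0 0 0 := fun j => by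
  simpa using HasSeriesDensity.zero

theorem add (hf : HasExpansion f v d) (hg : HasExpansion g w e) :
    HasExpansion (f + g) (v + w) (d + e) := fun j => by
  rw [add_mul]
  convert (hf j).add (hg j) using 1
  ring

theorem sub (hf : HasExpansion f v d) (hg : HasExpansion g w e) :
    HasExpansion (f - g) (v - w) (d - e) := fun j => by
  rw [sub_mul]
  convert (hf j).sub (hg j) using 1
  ring

theorem X_mul (hf : HasExpansion f v d) :
    HasExpansion (PowerSeries.X * f) (v / 8) (d / 8) := fun j => by
  rw [mul_assoc]
  convert (hf j).X_mul using 1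
  ring

theorem series_univ_mul (hf : HasExpansion f v d) :
    HasExpansion (series Set.univ * f) (4 * v) (4 * d + v) := fun j => by
  convert hf (j + 1) using 1
  · ring
  · push_cast
    ring

theorem X_pow_mul (k : ℕ) (hf : HasExpansion f v d) :
    HasExpansion (PowerSeries.X ^ k * f) (v / 8 ^ k) (d / 8 ^ k) := by
  induction k with
  | zero => simpa using hf
  | succ k ih =>
    convert ih.X_mul using 1
    · ring
    · rw [pow_succ]; field_simp
    · rw [pow_succ]; field_simp

end HasExpansion

end Comb

/-! ### Densities of sets determined by a truncation -/

namespace Pattern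

/-- The possible values of `trunc J`. -/
def truncations : ℕ → List Pattern
  | 0 => [hole]
  | J + 1 => S :: K :: (truncations J).flatMap fun p => (truncations J).map (app p)

theorem trunc_mem_truncations (J : ℕ) (t : Comb) : trunc J t ∈ truncations J := by
  induction J generalizing t with
  | zero => simp [trunc, truncations]
  | succ J ih => cases t <;> simp [trunc, truncations, ih]

theorem nodup_truncations (J : ℕ) : (truncations J).Nodup := by
  induction J with
  | zero => simp [truncations]
  | succ J ih =>
    have : ((truncations J).flatMap fun p => (truncations J).map (app p)).Nodup := by
      rw [List.nodup_flatMap]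
      refine ⟨fun p _ => ih.map fun _ _ h => by simpa using h, ih.imp ?_⟩
      intro p q hpq
      rw [Function.onFun, List.disjoint_left]
      simp only [List.mem_map, not_exists, not_and]
      rintro _ ⟨r, _, rfl⟩ s _ h
      simp only [app.injEq] at h
      exact hpq h.1.symm
    simp [truncations, this]

/-- The number of inner nodes. -/
def nodes : Pattern → ℕ
  | app p q => nodes p + nodes q + 1
  | _ => 0

/-- The number of holes. -/
def holes : Pattern → ℕ
  | hole => 1
  | app p q => holes p + holes q
  | _ => 0

/-- The density of the set of combinators matching the pattern. -/
noncomputable def weight (p : Pattern) : ℝ := p.holes * 4 ^ p.holes / 4 / 8 ^ p.nodes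

theorem weight_nonneg (p : Pattern) : 0 ≤ p.weight := by
  unfold weight
  positivity

open Comb

theorem series_trunc_eq {J : ℕ} {p : Pattern} (hp : p ∈ truncations J) :
    series {t | trunc J t = p} = PowerSeries.X ^ p.nodes * series Set.univ ^ p.holes := by
  induction J generalizing p with
  | zero =>
    obtain rfl : p = hole := by simpa [truncations] using hp
    simp [trunc, nodes, holes]
  | succ J ih =>
    simp only [truncations, List.mem_cons, List.mem_flatMap, List.mem_map] at hp
    obtain rfl | rfl | ⟨p, hp, q, hq, rfl⟩ := hp
    · have : {t | trunc (J + 1) t = Pattern.S} = {Comb.S} := by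
        ext t; cases t <;> simp [trunc]
      simp [this, series_singleton, size, nodes, holes]
    · have : {t | trunc (J + 1) t = Pattern.K} = {Comb.K} := by
        ext t; cases t <;> simp [trunc]
      simp [this, series_singleton, size, nodes, holes]
    · have : {t | trunc (J + 1) t = Pattern.app p q} =
          Set.image2 Comb.app {t | trunc J t = p} {t | trunc J t = q} := by
        ext t; cases t <;> simp [trunc]
      rw [this, series_image2_app, ih hp, ih hq, nodes, holes]
      ring

theorem hasDensity_trunc_mem {J : ℕ} {l : List Pattern} (hl : l.Nodup)
    (hlJ : ∀ p ∈ l, p ∈ truncations J) :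
    HasDensity {t | trunc J t ∈ l} (l.map weight).sum := by
  rw [hasDensity_iff]
  induction l with
  | nil =>
    have : series {t | trunc J t ∈ []} = 0 := by
      ext n
      simp [count]
    rw [this]
    simpa using HasSeriesDensity.zero
  | cons p l ih =>
    have hset : {t | trunc J t ∈ p :: l} = {t | trunc J t = p} ∪ {t | trunc J t ∈ l} := by
      ext t
      simp
    have hdisj : Disjoint {t | trunc J t = p} {t | trunc J t ∈ l} := by
      rw [Set.disjoint_left]
      rintro t rfl ht
      exact (List.nodup_cons.1 hl).1 ht
    have hser : series {t | trunc J t ∈ p :: l} =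
        series {t | trunc J t = p} + series {t | trunc J t ∈ l} := by
      ext n
      rw [map_add, coeff_series, coeff_series, coeff_series, hset, count_union_of_disjoint hdisj]
      push_cast
      rfl
    rw [hser, List.map_cons, List.sum_cons]
    refine .add ?_ (ih (List.nodup_cons.1 hl).2 fun q hq => hlJ q (List.mem_cons_of_mem _ hq))
    rw [series_trunc_eq (hlJ p List.mem_cons_self)]
    convert (HasExpansion.X_pow_mul p.nodes HasExpansion.one) p.holes using 1
    · ring
    · rw [weight]
      ring

theorem hasDensity_trunc (J : ℕ) (P : Pattern → Prop) [DecidablePred P] :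
    HasDensity {t | P (trunc J t)} (((truncations J).filter P).map weight).sum := by
  have : {t | P (trunc J t)} = {t | trunc J t ∈ (truncations J).filter P} := by
    ext t
    simp [trunc_mem_truncations]
  rw [this]
  exact hasDensity_trunc_mem ((nodup_truncations J).filter _) fun p hp => (List.mem_filter.1 hp).1

end Pattern

/-! ### Undecided truncations are rare -/

namespace Comb

open Filter Topology Pattern

theorem count_image2_app_le {A B : Set Comb} {f : PowerSeries ℝ}
    (h : ∀ n, (count B n : ℝ) ≤ PowerSeries.coeff n f) (n : ℕ) :
    (count (Set.image2 app A B) n : ℝ) ≤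
      PowerSeries.coeff n (PowerSeries.X * (series A * f)) := by
  rw [← coeff_series, series_image2_app]
  cases n with
  | zero => simp
  | succ n =>
    rw [PowerSeries.coeff_succ_X_mul, PowerSeries.coeff_succ_X_mul, PowerSeries.coeff_mul,
      PowerSeries.coeff_mul]
    refine Finset.sum_le_sum fun ij _ => ?_
    rw [coeff_series, coeff_series]
    exact mul_le_mul_of_nonneg_left (h _) (Nat.cast_nonneg _)

theorem count_image2_app_comm (A B : Set Comb) (n : ℕ) :
    count (Set.image2 app A B) n = count (Set.image2 app B A) n := by
  have := series_image2_app A B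
  rw [mul_comm (series A), ← series_image2_app] at this
  simpa using congrArg (PowerSeries.coeff n) this

theorem series_compl (A : Set Comb) : series Aᶜ = series Set.univ - series A := by
  rw [eq_sub_iff_add_eq]
  ext n
  rw [map_add, coeff_series, coeff_series, coeff_series, ← Nat.cast_add,
    ← count_union_of_disjoint disjoint_compl_left, Set.compl_union_self]

/-- A perturbed geometric sequence with summable perturbation is summable. -/
theorem summable_of_eq_mul_add {x e : ℕ → ℝ} {q : ℝ} (hq0 : 0 ≤ q) (hq1 : q < 1) (hx0 : 0 ≤ x 0)
    (he0 : ∀ n, 0 ≤ e n) (he : Summable e) (hx : ∀ n, x (n + 1) = q * x n + e n) :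
    (∀ n, 0 ≤ x n) ∧ Summable x := by
  have hnn : ∀ n, 0 ≤ x n := fun n => by
    induction n with
    | zero => exact hx0
    | succ n ih => rw [hx]; exact add_nonneg (mul_nonneg hq0 ih) (he0 n)
  refine ⟨hnn, summable_of_sum_range_le hnn (c := (x 0 + ∑' n, e n) / (1 - q)) fun n => ?_⟩
  rw [le_div_iff₀ (by linarith)]
  have h1 : ∑ i ∈ Finset.range n, x i ≤ ∑ i ∈ Finset.range (n + 1), x i := by
    rw [Finset.sum_range_succ]
    linarith [hnn n]
  have h2 : ∑ i ∈ Finset.range (n + 1), x i =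
      x 0 + (q * ∑ i ∈ Finset.range n, x i + ∑ i ∈ Finset.range n, e i) := by
    rw [Finset.sum_range_succ', add_comm, Finset.mul_sum, ← Finset.sum_add_distrib]
    simp only [hx]
  have h3 : ∑ i ∈ Finset.range n, e i ≤ ∑' n, e n := he.sum_le_tsum _ fun i _ => he0 i
  nlinarith

/-- A sequence of sets of combinators whose upper densities tend to zero, in a form that allows
induction: the sets have majorants with first-order expansions that are summable over the
sequence. -/
def Vanishing (H : ℕ → Set Comb) : Prop :=
  ∃ (f : ℕ → PowerSeries ℝ) (v d : ℕ → ℝ),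
    (∀ J n, (count (H J) n : ℝ) ≤ PowerSeries.coeff n (f J)) ∧
    (∀ J, HasExpansion (f J) (v J) (d J)) ∧ (∀ J, 0 ≤ v J) ∧ (∀ J, 0 ≤ d J) ∧
    Summable v ∧ Summable d

/-- The combinator `K K K`, which is a redex. -/
def kkk : Comb := app (app K K) K

/-- If a member of `H (J + 1)` has its left part in `H J`, or its right part in `H J` beside a left
part different from `K K K`, or its right part in `G J`, then `H` vanishes with `G`. The exclusion
of a single left part suffices to make the factor per level smaller than one. -/
theorem Vanishing.of_subset {G H : ℕ → Set Comb} (hG : Vanishing G)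
    (h : ∀ J, H (J + 1) ⊆ Set.image2 app (H J) Set.univ ∪ Set.image2 app {kkk}ᶜ (H J) ∪
      Set.image2 app Set.univ (G J)) : Vanishing H := by
  obtain ⟨g, w, e, hg, hexp, hw, he, hws, hes⟩ := hG
  let f : ℕ → PowerSeries ℝ := fun J => J.rec (series Set.univ) fun J f =>
    PowerSeries.X * (series Set.univ * f + (series Set.univ * f - PowerSeries.X ^ 2 * f) +
      series Set.univ * g J)
  -- The recursions for `v` and `d` are those that the expansion rules give for `f`; the factor is
  -- `511 / 512 = (4 + (4 - 1 / 64)) / 8`.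
  let v : ℕ → ℝ := fun J => J.rec 4 fun J v => 511 / 512 * v + w J / 2
  let d : ℕ → ℝ := fun J => J.rec 1 fun J d => 511 / 512 * d + (v J / 4 + e J / 2 + w J / 8)
  have hf : ∀ J, f (J + 1) =
    PowerSeries.X * (series Set.univ * f J + (series Set.univ * f J - PowerSeries.X ^ 2 * f J) +
      series Set.univ * g J) := fun _ => rfl
  have hv' : ∀ J, v (J + 1) = 511 / 512 * v J + w J / 2 := fun _ => rfl
  have hd' : ∀ J, d (J + 1) = 511 / 512 * d J + (v J / 4 + e J / 2 + w J / 8) := fun _ => rfl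
  obtain ⟨hv, hvs⟩ := summable_of_eq_mul_add (q := 511 / 512) (by norm_num) (by norm_num)
    (show (0 : ℝ) ≤ 4 by norm_num) (fun J => div_nonneg (hw J) (by norm_num)) (hws.div_const 2) hv'
  obtain ⟨hd, hds⟩ := summable_of_eq_mul_add (q := 511 / 512) (by norm_num) (by norm_num)
    (show (0 : ℝ) ≤ 1 by norm_num)
    (fun J => by have := hv J; have := hw J; have := he J; positivity)
    (((hvs.div_const 4).add (hes.div_const 2)).add (hws.div_const 8)) hd'
  refine ⟨f, v, d, fun J => ?_, fun J => ?_, hv, hd, hvs, hds⟩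
  · induction J with
    | zero =>
      intro n
      change (count (H 0) n : ℝ) ≤ PowerSeries.coeff n (series Set.univ)
      rw [coeff_series]
      exact_mod_cast count_mono (Set.subset_univ _) n
    | succ J ih =>
      intro n
      have h1 := (count_mono (h J) n).trans
        ((count_union_le _ _ n).trans (Nat.add_le_add_right (count_union_le _ _ n) _))
      rw [count_image2_app_comm (H J)] at h1
      have h2 : (count (H (J + 1)) n : ℝ) ≤ count (Set.image2 app Set.univ (H J)) n +
        count (Set.image2 app {kkk}ᶜ (H J)) n + count (Set.image2 app Set.univ (G J)) n := by
        exact_mod_cast h1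
      have h3 := count_image2_app_le (A := Set.univ) ih n
      have h4 := count_image2_app_le (A := {kkk}ᶜ) ih n
      have h5 := count_image2_app_le (A := Set.univ) (hg J) n
      rw [series_compl, series_singleton, show kkk.size = 2 from rfl, sub_mul] at h4
      rw [hf, mul_add, mul_add, map_add, map_add]
      linarith
  · induction J with
    | zero =>
      convert HasExpansion.one.series_univ_mul using 1
      · simp [f]
      · simp [v]
      · simp [d]
    | succ J ih =>
      rw [hf]
      convert ((ih.series_univ_mul.add (ih.series_univ_mul.sub (ih.X_pow_mul 2))).add
        (hexp J).series_univ_mul).X_mul using 1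
      · rw [hv']; ring
      · rw [hd']; ring

/-- Depth three is the least at which truncation leaves `K K K` intact, so that a left part
different from it can be recognised on the truncation. -/
theorem vanishing_sparseHole (m : ℕ) :
    Vanishing fun J => {t | SparseHole m (trunc (J + 3) t)} := by
  have key (J : ℕ) {x : Comb} (hx : trunc (J + 3) x ≠ Pattern.kkk) : x ∈ ({kkk}ᶜ : Set Comb) := by
    rintro rfl
    exact hx rfl
  induction m with
  | zero =>
    have h0 : Vanishing fun _ => ∅ :=
      ⟨fun _ => 0, fun _ => 0, fun _ => 0, by simp [count], fun _ => HasExpansion.zero,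
        by simp, by simp, summable_zero, summable_zero⟩
    refine h0.of_subset fun J t ht => ?_
    rcases t with _ | _ | ⟨x, y⟩
    · cases ht
    · cases ht
    · rcases ht with _ | ⟨_, ht⟩ | ⟨hn, ht⟩ | _
      · exact Or.inl (Or.inl ⟨x, ht, y, trivial, rfl⟩)
      · exact Or.inl (Or.inr ⟨x, key J hn, y, ht, rfl⟩)
  | succ m ih =>
    refine ih.of_subset fun J t ht => ?_
    rcases t with _ | _ | ⟨x, y⟩
    · cases ht
    · cases ht
    · rcases ht with _ | ⟨_, ht⟩ | ⟨hn, ht⟩ | ⟨_, ht⟩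
      · exact Or.inl (Or.inl ⟨x, ht, y, trivial, rfl⟩)
      · exact Or.inl (Or.inr ⟨x, key J hn, y, ht, rfl⟩)
      · exact Or.inr ⟨x, trivial, y, ht, rfl⟩

/-- The density of the set of combinators on whose truncation at depth `J` lazy reduction is
undecided. -/
noncomputable def undecidedDensity (m J : ℕ) : ℝ :=
  (((truncations J).filter (Undecided m)).map weight).sum

/-- The density of the set of combinators whose truncation at depth `J` is accepted. -/
noncomputable def acceptedDensity (m J : ℕ) : ℝ :=
  (((truncations J).filter (Accepts m)).map weight).sum

theorem tendsto_undecidedDensity (m : ℕ) : Tendsto (undecidedDensity m) atTop (𝓝 0) := by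
  obtain ⟨f, v, d, hf, hexp, -, -, -, hd⟩ := vanishing_sparseHole m
  rw [← tendsto_add_atTop_iff_nat 3]
  refine squeeze_zero (fun J => List.sum_nonneg ?_) (fun J => ?_) hd.tendsto_atTop_zero
  · simp only [List.mem_map]
    rintro _ ⟨p, _, rfl⟩
    exact p.weight_nonneg
  · refine le_of_tendsto_of_tendsto' (hasDensity_trunc (J + 3) (Undecided m))
      (hexp J).hasSeriesDensity fun n => ?_
    refine div_le_div_of_nonneg_right (le_trans ?_ (hf J n)) (Nat.cast_nonneg _)
    exact_mod_cast count_mono (fun t ht => Undecided.sparseHole ht) n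

/-- The density exists and lies between the density of the accepted truncations and the density of
the accepted or undecided ones, for every depth. -/
theorem exists_hasDensity_normalisesIn (m : ℕ) :
    ∃ d, HasDensity {t | NormalisesIn m t} d ∧
      ∀ J, acceptedDensity m J ≤ d ∧ d ≤ acceptedDensity m J + undecidedDensity m J := by
  have hacc (J : ℕ) := hasDensity_trunc J (Accepts m)
  have hund (J : ℕ) := hasDensity_trunc J (Undecided m)
  have hlow (J n : ℕ) : (count {t | Accepts m (trunc J t)} n : ℝ) / count Set.univ n ≤
      (count {t | NormalisesIn m t} n : ℝ) / count Set.univ n := by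
    refine div_le_div_of_nonneg_right ?_ (Nat.cast_nonneg _)
    refine Nat.cast_le.2 (count_mono (fun t ht => ?_) n)
    exact ((matches_trunc J t).normalisesIn_iff (not_undecided_of_accepts ht)).2 ht
  have hupp (J n : ℕ) : (count {t | NormalisesIn m t} n : ℝ) / count Set.univ n ≤
      (count {t | Accepts m (trunc J t)} n : ℝ) / count Set.univ n +
        (count {t | Undecided m (trunc J t)} n : ℝ) / count Set.univ n := by
    rw [← add_div]
    refine div_le_div_of_nonneg_right ?_ (Nat.cast_nonneg _)
    rw [← Nat.cast_add]
    refine Nat.cast_le.2 ((count_mono (fun t ht => ?_) n).trans (count_union_le _ _ n))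
    by_cases hu : Undecided m (trunc J t)
    · exact Or.inr hu
    · exact Or.inl (((matches_trunc J t).normalisesIn_iff hu).1 ht)
  have hcauchy : CauchySeq fun n =>
      (count {t | NormalisesIn m t} n : ℝ) / (count Set.univ n : ℝ) := by
    rw [Metric.cauchySeq_iff']
    intro ε hε
    obtain ⟨J, hJ⟩ := ((tendsto_undecidedDensity m).eventually_lt_const
      (show (0 : ℝ) < ε / 4 by linarith)).exists
    have h1 := (hacc J).eventually_const_lt (sub_lt_self (acceptedDensity m J)
      (show (0 : ℝ) < ε / 4 by linarith))
    have h2 := ((hacc J).add (hund J)).eventually_lt_const (lt_add_of_pos_right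
      (acceptedDensity m J + undecidedDensity m J) (show (0 : ℝ) < ε / 4 by linarith))
    obtain ⟨N, hN⟩ := eventually_atTop.1 (h1.and h2)
    refine ⟨N, fun n hn => ?_⟩
    have hn' := hN n hn
    have hN' := hN N le_rfl
    rw [Real.dist_eq, abs_lt]
    constructor <;> linarith [hlow J n, hlow J N, hupp J n, hupp J N]
  obtain ⟨d, hd⟩ := cauchySeq_tendsto_of_complete hcauchy
  exact ⟨d, hd, fun J => ⟨le_of_tendsto_of_tendsto' (hacc J) hd (hlow J),
    le_of_tendsto_of_tendsto' hd ((hacc J).add (hund J)) (hupp J)⟩⟩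

end Comb

/-! ### Computability of the approximations -/

namespace Pattern

/-- A bijective numbering of the patterns. -/
def toNat : Pattern → ℕ
  | S => 0
  | K => 1
  | hole => 2
  | app p q => Nat.pair (toNat p) (toNat q) + 3

/-- The pattern with a given number. -/
def ofNat : ℕ → Pattern
  | 0 => S
  | 1 => K
  | 2 => hole
  | n + 3 => app (ofNat n.unpair.1) (ofNat n.unpair.2)
decreasing_by
  · have := Nat.unpair_left_le n
    omega
  · have := Nat.unpair_right_le n
    omega

@[simp]
theorem ofNat_toNat (p : Pattern) : ofNat (toNat p) = p := by
  induction p with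
  | app p q ihp ihq => simp [toNat, ofNat, ihp, ihq]
  | _ => simp [toNat, ofNat]

@[simp]
theorem toNat_ofNat (n : ℕ) : toNat (ofNat n) = n := by
  fun_induction ofNat n with
  | case4 n ih1 ih2 => simp [toNat, ih1, ih2]
  | _ => simp [toNat]

/-- The numbering of the patterns as an equivalence. -/
def equivNat : Pattern ≃ ℕ := ⟨toNat, ofNat, ofNat_toNat, toNat_ofNat⟩

instance : Primcodable Pattern := Primcodable.ofEquiv ℕ equivNat

theorem primrec_toNat : Primrec toNat := Primrec.of_equiv (e := equivNat)

theorem primrec_ofNat : Primrec ofNat := Primrec.of_equiv_symm (e := equivNat)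

theorem primrec_app : Primrec₂ app := by
  refine (primrec_ofNat.comp (Primrec.nat_add.comp (Primrec₂.natPair.comp
    (primrec_toNat.comp Primrec.fst) (primrec_toNat.comp Primrec.snd)) (Primrec.const 3))).of_eq ?_
  rintro ⟨p, q⟩
  exact ofNat_toNat (app p q)

/-- The left part of an application. -/
def left (p : Pattern) : Pattern := ofNat (toNat p - 3).unpair.1

/-- The right part of an application. -/
def right (p : Pattern) : Pattern := ofNat (toNat p - 3).unpair.2

@[simp]
theorem left_app (p q : Pattern) : left (app p q) = p := by simp [left, toNat]

@[simp]
theorem right_app (p q : Pattern) : right (app p q) = q := by simp [right, toNat]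

theorem primrec_left : Primrec left :=
  primrec_ofNat.comp (Primrec.fst.comp (Primrec.unpair.comp
    (Primrec.nat_sub.comp primrec_toNat (Primrec.const 3))))

theorem primrec_right : Primrec right :=
  primrec_ofNat.comp (Primrec.snd.comp (Primrec.unpair.comp
    (Primrec.nat_sub.comp primrec_toNat (Primrec.const 3))))

/-- A function defined by structural recursion on patterns is primitive recursive if its recursion
step is. -/
theorem primrec_of_rec {σ : Type*} [Primcodable σ] {f : Pattern → σ}
    {g : (Pattern × Pattern) × σ × σ → σ} (hg : Primrec g)
    (hf : ∀ p q, f (app p q) = g ((p, q), f p, f q)) : Primrec f := by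
  have happ : PrimrecPred fun p : Pattern => 3 ≤ toNat p :=
    Primrec.nat_le.comp (Primrec.const 3) primrec_toNat
  have hl : Primrec fun p : Pattern => if 3 ≤ toNat p then [left p, right p] else [] :=
    Primrec.ite happ (Primrec.list_cons.comp primrec_left
      (Primrec.list_cons.comp primrec_right (Primrec.const []))) (Primrec.const [])
  have hleaf : Primrec fun p : Pattern => if p = S then f S else if p = K then f K else f hole :=
    Primrec.ite (Primrec.eq.comp Primrec.id (Primrec.const S)) (Primrec.const _)
      (Primrec.ite (Primrec.eq.comp Primrec.id (Primrec.const K)) (Primrec.const _)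
        (Primrec.const _))
  have hG : Primrec₂ fun (p : Pattern) (L : List σ) => if 3 ≤ toNat p then
      (L[0]?).bind fun a => (L[1]?).map fun b => g ((left p, right p), a, b)
      else some (if p = S then f S else if p = K then f K else f hole) := by
    refine Primrec.ite (happ.comp Primrec.fst) ?_ (Primrec.option_some.comp
      (hleaf.comp Primrec.fst))
    refine Primrec.option_bind (Primrec.list_getElem?.comp Primrec.snd (Primrec.const 0)) ?_
    refine Primrec.option_map
      (Primrec.list_getElem?.comp (Primrec.snd.comp Primrec.fst) (Primrec.const 1)) ?_
    have hp : Primrec fun x : ((Pattern × List σ) × σ) × σ => x.1.1.1 :=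
      Primrec.fst.comp (Primrec.fst.comp Primrec.fst)
    exact hg.comp (((primrec_left.comp hp).pair (primrec_right.comp hp)).pair
      ((Primrec.snd.comp Primrec.fst).pair Primrec.snd))
  refine Primrec.nat_omega_rec' f primrec_toNat hl hG ?_ ?_
  · intro p q hq
    split at hq
    · have h1 := Nat.unpair_left_le (toNat p - 3)
      have h2 := Nat.unpair_right_le (toNat p - 3)
      simp only [List.mem_cons, List.not_mem_nil, or_false] at hq
      rcases hq with rfl | rfl
      · simp only [left, toNat_ofNat]
        omega
      · simp only [right, toNat_ofNat]
        omega
    · simp at hq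
  · intro p
    cases p with
    | app p q => simp [toNat, hf]
    | _ => simp [toNat]

theorem step_app (p q : Pattern) :
    step (app p q) = if p = app K (right p) then some (some (right p))
      else if p = app (app S (right (left p))) (right p) then
        some (some (app (app (right (left p)) q) (app (right p) q)))
      else (step p).bind fun r => r.elim ((step q).map (Option.map (app p)))
        fun p' => some (some (app p' q)) := by
  split
  · rename_i h
    rw [h]
    simp [step]
  · split
    · rename_i _ h
      rw [h]
      simp [step]
    · rename_i h1 h2
      rw [step]
      · rcases step p with _ | _ | p' <;> rfl
      · rintro x rfl
        exact h1 (by simp)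
      · rintro x y rfl
        exact h2 (by simp)

theorem primrec_optionElim {α β σ : Type*} [Primcodable α] [Primcodable β] [Primcodable σ]
    {o : α → Option β} {f : α → σ} {g : α → β → σ} (ho : Primrec o) (hf : Primrec f)
    (hg : Primrec₂ g) : Primrec fun a => (o a).elim (f a) (g a) :=
  (Primrec.option_casesOn ho hf hg).of_eq fun a => by cases o a <;> rfl

theorem primrec_step : Primrec step := by
  refine primrec_of_rec (g := fun x => if x.1.1 = app K (right x.1.1) then
      some (some (right x.1.1))
    else if x.1.1 = app (app S (right (left x.1.1))) (right x.1.1) then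
      some (some (app (app (right (left x.1.1)) x.1.2) (app (right x.1.1) x.1.2)))
    else x.2.1.bind fun r => r.elim (x.2.2.map (Option.map (app x.1.1)))
      fun p' => some (some (app p' x.1.2))) ?_ step_app
  have hp : Primrec fun x : (Pattern × Pattern) × Option (Option Pattern) ×
      Option (Option Pattern) => x.1.1 := Primrec.fst.comp Primrec.fst
  have hq : Primrec fun x : (Pattern × Pattern) × Option (Option Pattern) ×
      Option (Option Pattern) => x.1.2 := Primrec.snd.comp Primrec.fst
  have hr := primrec_right.comp hp
  have hlr := primrec_right.comp (primrec_left.comp hp)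
  have hsome {α : Type} [Primcodable α] {f : α → Pattern} (hf : Primrec f) :
      Primrec fun a => some (some (f a)) := Primrec.option_some.comp (Primrec.option_some.comp hf)
  refine Primrec.ite (Primrec.eq.comp hp (primrec_app.comp (Primrec.const K) hr)) (hsome hr)
    (Primrec.ite (Primrec.eq.comp hp (primrec_app.comp (primrec_app.comp (Primrec.const S) hlr) hr))
      (hsome (primrec_app.comp (primrec_app.comp hlr hq) (primrec_app.comp hr hq))) ?_)
  refine Primrec.option_bind (Primrec.fst.comp Primrec.snd) ?_
  refine primrec_optionElim Primrec.snd ?_ ?_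
  · refine Primrec.option_map (Primrec.snd.comp (Primrec.snd.comp Primrec.fst)) ?_
    exact Primrec.option_map Primrec.snd (primrec_app.comp (hp.comp (Primrec.fst.comp
      (Primrec.fst.comp Primrec.fst))) Primrec.snd)
  · exact hsome (primrec_app.comp Primrec.snd (hq.comp (Primrec.fst.comp Primrec.fst)))

/-- The last step of a run can be split off instead of the first one. -/
theorem run_succ' (m : ℕ) (p : Pattern) :
    run (m + 1) p = (run m p).bind fun r => r.elim (some none) step := by
  induction m generalizing p with
  | zero => rcases h : step p with _ | _ | p' <;> simp [run, h]
  | succ m ih =>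
    rw [run_succ, run_succ m]
    rcases h : step p with _ | _ | p'
    · rfl
    · rfl
    · exact ih p'

theorem primrec_run : Primrec₂ run := by
  have h : Primrec₂ fun (p : Pattern) (m : ℕ) =>
      Nat.rec (motive := fun _ => Option (Option Pattern))
      (some (some p)) (fun _ s => s.bind fun r => r.elim (some none) step) m := by
    refine Primrec.nat_rec (f := fun p : Pattern => some (some p))
      (g := fun _ x => x.2.bind fun r => r.elim (some none) step)
      (Primrec.option_some.comp Primrec.option_some) ?_
    refine Primrec.option_bind (Primrec.snd.comp Primrec.snd) ?_
    exact primrec_optionElim Primrec.snd (Primrec.const _) (primrec_step.comp Primrec.snd).to₂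
  refine h.swap.of_eq fun m p => ?_
  induction m with
  | zero => rfl
  | succ m ih =>
    rw [run_succ', ← ih]

theorem primrecRel_undecided : PrimrecRel Undecided :=
  Primrec.eq.comp (primrec_run.comp (Primrec.succ.comp Primrec.fst) Primrec.snd) (Primrec.const _)

theorem primrecRel_accepts : PrimrecRel Accepts :=
  (Primrec.eq.comp (primrec_run.comp (Primrec.succ.comp Primrec.fst) Primrec.snd)
    (Primrec.const _)).and
  (Primrec.eq.comp (primrec_run.comp Primrec.fst Primrec.snd) (Primrec.const _)).not

theorem primrec_nodes : Primrec nodes :=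
  primrec_of_rec (g := fun x => x.2.1 + x.2.2 + 1) (Primrec.succ.comp (Primrec.nat_add.comp
    (Primrec.fst.comp Primrec.snd) (Primrec.snd.comp Primrec.snd))) fun _ _ => rfl

theorem primrec_holes : Primrec holes :=
  primrec_of_rec (g := fun x => x.2.1 + x.2.2) (Primrec.nat_add.comp
    (Primrec.fst.comp Primrec.snd) (Primrec.snd.comp Primrec.snd)) fun _ _ => rfl

theorem primrec_truncations : Primrec truncations := by
  have h : Primrec₂ fun (_ : ℕ) (x : ℕ × List Pattern) =>
      S :: K :: x.2.flatMap fun p => x.2.map (app p) := by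
    refine Primrec.list_cons.comp (Primrec.const S) (Primrec.list_cons.comp (Primrec.const K) ?_)
    refine Primrec.list_flatMap (Primrec.snd.comp Primrec.snd) ?_
    exact Primrec.list_map (Primrec.snd.comp (Primrec.snd.comp Primrec.fst))
      (primrec_app.comp (Primrec.snd.comp Primrec.fst) Primrec.snd)
  refine (Primrec.nat_rec' Primrec.id (Primrec.const [hole]) h).of_eq fun J => ?_
  induction J with
  | zero => rfl
  | succ J ih => rw [truncations, ← ih]; rfl

theorem nodes_lt_of_mem_truncations {J : ℕ} {p : Pattern} (hp : p ∈ truncations J) :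
    p.nodes < 2 ^ J := by
  induction J generalizing p with
  | zero =>
    obtain rfl : p = hole := by simpa [truncations] using hp
    simp [nodes]
  | succ J ih =>
    simp only [truncations, List.mem_cons, List.mem_flatMap, List.mem_map] at hp
    obtain rfl | rfl | ⟨p, hp, q, hq, rfl⟩ := hp
    · simp [nodes]
    · simp [nodes]
    · have := ih hp
      have := ih hq
      rw [nodes, pow_succ]
      omega

/-- The common denominator of the weights of all truncations at depth `J`. -/
def denom (J : ℕ) : ℕ := 4 * 8 ^ 2 ^ J

/-- The numerator of `weight p` over the denominator `denom J`. -/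
def numer (J : ℕ) (p : Pattern) : ℕ := p.holes * 4 ^ p.holes * 8 ^ (2 ^ J - p.nodes)

theorem denom_pos (J : ℕ) : 0 < denom J := by
  unfold denom
  positivity

theorem numer_div_denom {J : ℕ} {p : Pattern} (hp : p ∈ truncations J) :
    (numer J p : ℝ) / denom J = weight p := by
  have h := (nodes_lt_of_mem_truncations hp).le
  have h8 : (8 : ℝ) ^ 2 ^ J = 8 ^ (2 ^ J - p.nodes) * 8 ^ p.nodes := by
    rw [← pow_add, Nat.sub_add_cancel h]
  rw [numer, denom, weight]
  push_cast
  rw [h8]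
  field_simp

/-- The numerator over `denom J` of the density of the combinators whose truncation at depth `J`
satisfies `P`. -/
def totalNumer (P : Pattern → Prop) [DecidablePred P] (J : ℕ) : ℕ :=
  ((truncations J).map fun p => if P p then numer J p else 0).sum

theorem totalNumer_div_denom (P : Pattern → Prop) [DecidablePred P] (J : ℕ) :
    (totalNumer P J : ℝ) / denom J = (((truncations J).filter P).map weight).sum := by
  have key (l : List Pattern) (hl : ∀ p ∈ l, p ∈ truncations J) :
      (((l.map fun p => if P p then numer J p else 0).sum : ℕ) : ℝ) / denom J =
        ((l.filter P).map weight).sum := by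
    induction l with
    | nil => simp
    | cons p l ih =>
      have hp := numer_div_denom (hl p List.mem_cons_self)
      have ih := ih fun q hq => hl q (List.mem_cons_of_mem _ hq)
      rw [List.map_cons, List.sum_cons, Nat.cast_add, add_div, ih]
      by_cases h : P p
      · simp [h, hp]
      · simp [h]
  exact key _ fun _ h => h

theorem primrec_natPow : Primrec₂ ((· ^ ·) : ℕ → ℕ → ℕ) := by
  have h : Primrec₂ fun a b : ℕ =>
      Nat.rec (motive := fun _ => ℕ) 1 (fun _ s => s * a) b :=
    Primrec.nat_rec (Primrec.const 1)
      (Primrec.nat_mul.comp (Primrec.snd.comp Primrec.snd) Primrec.fst).to₂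
  refine h.of_eq fun a b => ?_
  induction b with
  | zero => rfl
  | succ b ih => rw [pow_succ, ← ih]

theorem primrec_denom : Primrec denom :=
  Primrec.nat_mul.comp (Primrec.const 4) (primrec_natPow.comp (Primrec.const 8)
    (primrec_natPow.comp (Primrec.const 2) Primrec.id))

theorem primrec_numer : Primrec₂ numer :=
  Primrec.nat_mul.comp
    (Primrec.nat_mul.comp (primrec_holes.comp Primrec.snd)
      (primrec_natPow.comp (Primrec.const 4) (primrec_holes.comp Primrec.snd)))
    (primrec_natPow.comp (Primrec.const 8)
      (Primrec.nat_sub.comp (primrec_natPow.comp (Primrec.const 2) Primrec.fst)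
        (primrec_nodes.comp Primrec.snd)))

theorem primrec_totalNumer {P : ℕ → Pattern → Prop} [∀ m, DecidablePred (P m)]
    (hP : PrimrecRel P) : Primrec₂ fun m J => totalNumer (P m) J := by
  have hmap : Primrec fun x : ℕ × ℕ =>
      (truncations x.2).map fun p => if P x.1 p then numer x.2 p else 0 :=
    Primrec.list_map (primrec_truncations.comp Primrec.snd)
      (Primrec.ite (hP.comp (Primrec.fst.comp Primrec.fst) Primrec.snd)
        (primrec_numer.comp (Primrec.snd.comp Primrec.fst) Primrec.snd) (Primrec.const 0))
  refine (Primrec.list_foldr hmap (Primrec.const 0) (h := fun _ x => x.1 + x.2)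
    (Primrec.nat_add.comp (Primrec.fst.comp Primrec.snd) (Primrec.snd.comp Primrec.snd))).of_eq ?_
  rintro ⟨m, J⟩
  exact List.sum_eq_foldr.symm

end Pattern

open Pattern in
/-- An algorithm finds rational approximations of the densities of the accepted truncations, at
depths where the undecided ones are negligible. -/
theorem exists_computable_approximation :
    ∃ p : ℕ → ℕ → ℤ, Computable₂ p ∧ ∀ m k, ∃ J,
      Comb.undecidedDensity m J * 2 ^ k ≤ 1 ∧
        (p m k : ℝ) - 1 ≤ Comb.acceptedDensity m J * 2 ^ k ∧
          Comb.acceptedDensity m J * 2 ^ k ≤ p m k := by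
  let approx (x : ℕ × ℕ) (J : ℕ) : Option ℤ :=
    if totalNumer (Undecided x.1) J * 2 ^ x.2 ≤ denom J then
      some ((totalNumer (Accepts x.1) J * 2 ^ x.2 / denom J + 1 : ℕ) : ℤ) else none
  have hcast : Primrec fun n : ℕ => (n : ℤ) :=
    -- The natural number `n` has the code `2 * n` as an integer.
    Primrec.encode_iff.1 (Primrec.nat_double.of_eq fun n => rfl)
  have happrox : Primrec₂ approx := by
    have hpow : Primrec fun y : (ℕ × ℕ) × ℕ => 2 ^ y.1.2 :=
      primrec_natPow.comp (Primrec.const 2) (Primrec.snd.comp Primrec.fst)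
    have hden : Primrec fun y : (ℕ × ℕ) × ℕ => denom y.2 := primrec_denom.comp Primrec.snd
    have htot {P : ℕ → Pattern → Prop} [∀ m, DecidablePred (P m)] (hP : PrimrecRel P) :
        Primrec fun y : (ℕ × ℕ) × ℕ => totalNumer (P y.1.1) y.2 :=
      (primrec_totalNumer hP).comp (Primrec.fst.comp Primrec.fst) Primrec.snd
    exact Primrec.ite
      (Primrec.nat_le.comp (Primrec.nat_mul.comp (htot primrecRel_undecided) hpow) hden)
      (Primrec.option_some.comp (hcast.comp (Primrec.succ.comp (Primrec.nat_div.comp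
        (Primrec.nat_mul.comp (htot primrecRel_accepts) hpow) hden))))
      (Primrec.const none)
  have hdom (x : ℕ × ℕ) : (Nat.rfindOpt (approx x)).Dom := by
    rw [Nat.rfindOpt_dom]
    obtain ⟨J, hJ⟩ := ((Comb.tendsto_undecidedDensity x.1).eventually_lt_const
      (show (0 : ℝ) < 1 / 2 ^ x.2 by positivity)).exists
    refine ⟨J, _, if_pos ?_⟩
    have hd : (0 : ℝ) < denom J := by exact_mod_cast denom_pos J
    rw [Comb.undecidedDensity, ← totalNumer_div_denom, div_lt_div_iff₀ hd (by positivity),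
      one_mul] at hJ
    exact_mod_cast hJ.le
  refine ⟨fun m k => (Nat.rfindOpt (approx (m, k))).get (hdom (m, k)), ?_, fun m k => ?_⟩
  · exact (Partrec.rfindOpt happrox.to_comp).of_eq fun x => (Part.some_get (hdom x)).symm
  · obtain ⟨J, hJ⟩ := Nat.rfindOpt_spec (Part.get_mem (hdom (m, k)))
    refine ⟨J, ?_⟩
    beta_reduce
    generalize (Nat.rfindOpt (approx (m, k))).get (hdom (m, k)) = z at hJ ⊢
    obtain ⟨h, rfl⟩ : totalNumer (Undecided m) J * 2 ^ k ≤ denom J ∧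
        ((totalNumer (Accepts m) J * 2 ^ k / denom J + 1 : ℕ) : ℤ) = z := by
      simpa [approx] using hJ
    have hd : (0 : ℝ) < denom J := by exact_mod_cast denom_pos J
    rw [Comb.undecidedDensity, Comb.acceptedDensity, ← totalNumer_div_denom,
      ← totalNumer_div_denom, div_mul_eq_mul_div, div_mul_eq_mul_div, div_le_one hd,
      le_div_iff₀ hd, div_le_iff₀ hd]
    have h1 := Nat.div_mul_le_self (totalNumer (Accepts m) J * 2 ^ k) (denom J)
    have h2 := (Nat.lt_mul_div_succ (totalNumer (Accepts m) J * 2 ^ k) (denom_pos J)).le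
    rw [mul_comm (denom J)] at h2
    refine ⟨by exact_mod_cast h, ?_, ?_⟩
    · push_cast
      rw [add_sub_cancel_right]
      exact_mod_cast h1
    · exact_mod_cast h2

theorem mainTheorem7 :
    ∃ d : ℕ → ℝ, (∀ m, Comb.HasDensity {t | Comb.NormalisesIn m t} (d m)) ∧
      IsComputableRealSeq d := by
  choose d hd hbound using Comb.exists_hasDensity_normalisesIn
  obtain ⟨p, hp, h⟩ := exists_computable_approximation
  refine ⟨d, hd, p, hp, fun m k => ?_⟩
  obtain ⟨J, h1, h2, h3⟩ := h m k
  obtain ⟨h4, h5⟩ := hbound m J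
  have h2k : (0 : ℝ) < 2 ^ k := by positivity
  have h6 := mul_le_mul_of_nonneg_right h4 h2k.le
  have h7 := mul_le_mul_of_nonneg_right h5 h2k.le
  rw [add_mul] at h7
  rw [le_div_iff₀ h2k, ← abs_of_pos h2k, ← abs_mul, abs_of_pos h2k, sub_mul,
    div_mul_cancel₀ _ h2k.ne', abs_le]
  constructor <;> linarith
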